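/- Let $\lambda>0$. Let $L_n^{(1)}(x)=\sum_{k=0}^{n}(-1)^k\binom{n+1}{n-k}\frac{x^k}{k!}$ be the Laguerre polynomials with parameter $1$, and consider the Sobolev inner product $$\langle u,v\rangle_\lambda=\lambda\int_0^{+\infty}u(x)v(x)\,\frac1x\,dx+\int_0^{+\infty}u'(x)v'(x)\,dx .$$ Let $\{S_n(x)\,x\,e^{-x/2}\}_{n\ge 0}$ be the sequence of functions obtained by applying the Gram–Schmidt process with respect to $\langle\cdot,\cdot\rangle_\lambda$ to the sequence $\{x^k\,x\,e^{-x/2}\}_{k\ge0}$, where the polynomial $S_n$ of degree $n$ is normalized to have the same leading coefficient $(-1)^n/n!$ as $L_n^{(1)}$. Theorem. $L_n^{(1)}(x)\neq 0$ for all $n\ge 0$ and all $x\in\mathbb C\setminus(0,+\infty)$, and for every $x\in\mathbb C\setminus(0,+\infty)$ $$\lim_{n\to+\infty}\frac{S_n(x)}{\sqrt{n+1}\,L_n^{(1)}(x)}=0 .$$ The convergence is uniform on every compact subset of $\mathbb C\setminus[0,+\infty)$. More generally, it is uniform on every closed set $K\subset\mathbb C$ (possibly unbounded, possibly containing $0$)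 that has empty intersection with $(0,+\infty)$ and does not approach the ray tangentially at $0$ or at infinity, in the sense that there is a constant $c>0$ with $\operatorname{dist}(x,[0,+\infty))\ge c\,|x|$ for all $x\in K$. -/

import Mathlib

open Polynomial

noncomputable section

/-- The Laguerre polynomial `L_n^{(α)}` for a natural number `α`, with real coefficients:
`L_n^{(α)}(x) = ∑_{k=0}^n (-1)^k binom(n+α, n-k) x^k / k!`. -/
def laguerrePoly (α n : ℕ) : ℝ[X] :=
  ∑ k ∈ Finset.range (n + 1),
    C ((-1 : ℝ) ^ k * ((n + α).choose (n - k) : ℝ) / (k.factorial : ℝ)) * X ^ k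

/-- The Sobolev inner product
`⟨u, v⟩_lam = lam ∫_0^∞ u(x) v(x) / x dx + ∫_0^∞ u'(x) v'(x) dx`. -/
def sobolevInner (lam : ℝ) (u v : ℝ → ℝ) : ℝ :=
  lam * (∫ x in Set.Ioi (0 : ℝ), u x * v x * (1 / x)) +
    ∫ x in Set.Ioi (0 : ℝ), deriv u x * deriv v x

/-- The test function `p(x) x e^{-x/2}` attached to a polynomial `p`. -/
def testFun (p : ℝ[X]) (x : ℝ) : ℝ := p.eval x * x * Real.exp (-x / 2)

/-- The Gram-Schmidt process applied to the functions `x^k x e^{-x/2}`, `k = 0, 1, …`, with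
respect to `sobolevInner lam`, recorded through the polynomial factors: the `n`-th function that
it yields is `testFun (sobolevGramSchmidt lam n)`, and these polynomials are monic. -/
def sobolevGramSchmidt (lam : ℝ) (n : ℕ) : ℝ[X] :=
  X ^ n - ∑ i : Fin n,
    C (sobolevInner lam (testFun (X ^ n)) (testFun (sobolevGramSchmidt lam i)) /
        sobolevInner lam (testFun (sobolevGramSchmidt lam i))
          (testFun (sobolevGramSchmidt lam i))) * sobolevGramSchmidt lam i
termination_by n
decreasing_by all_goals exact i.isLt

/-- The Laguerre-Sobolev polynomial `S_n`: the `n`-th Gram-Schmidt polynomial normalized to have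
the leading coefficient `(-1)^n / n!` of `L_n^{(1)}`. -/
def laguerreSobolev (lam : ℝ) (n : ℕ) : ℝ[X] :=
  C ((-1 : ℝ) ^ n / (n.factorial : ℝ)) * sobolevGramSchmidt lam n

/-- The quotient `S_n(x) / (√(n+1) L_n^{(1)}(x))` at a complex point `x`. -/
def sobolevRatio (lam : ℝ) (n : ℕ) (x : ℂ) : ℂ :=
  aeval x (laguerreSobolev lam n) /
    (((Real.sqrt ((n : ℝ) + 1) : ℝ) : ℂ) * aeval x (laguerrePoly 1 n))

end

open Polynomial ComplexConjugate

/-! ### Laguerre polynomials -/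

/-! Write b_n = L_n^{(1)}(x)/(n+1). Multiplied by x, these polynomials become differences of
consecutive `laguerrePoly 0` polynomials, which are orthonormal for e^{-x}. The derivatives of the
test functions come from half sums of the same pairs. In this basis the Sobolev Gram matrix is
therefore tridiagonal, with constant off-diagonal entry 1/4, and Gram-Schmidt collapses to T_{n+1} =
b_{n+1} - T_n/r_n, where r_n is four times a squared norm and r_{n+1} = 2 + 4 lam/(n+2) - 1/r_n. The
quotient to be studied is T_n/(√(n+1) b_n).

Two estimates then suffice. The scalar recurrence gives r_n ≥ 1 + √(2 lam)/√(n+1)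
(`one_add_le_sobolevNormSeq`). This damps the alternating sum: T_n is g_n b_n with 0 ≤ g_n ≤ 1, plus
a remainder at most √(A_n W_n), where A_n = ∑_{k<n} (k+1)(k+2)|b_{k+1} - b_k|² and W_n = O(n^{-3/2})
(`norm_le_of_alternating_recurrence`, `exists_dampedSum_le`). On the other hand, the Laguerre
recurrence is in divergence form, and summing it by parts against conj b_n gives n(n+1)(b_n -
b_{n-1}) conj b_n = A_n - x B_n with B_n > 0 for n ≥ 1 (`energy_identity`). Hence b_n cannot vanish
off the ray, and when dist(x, ray) ≥ c|x| one gets A_n ≤ (1 + 1/c)² n(n+1)|b_n|²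
(`dirichletEnergy_le`).

Together these bound the quotient by 1/√(n+1) + (1 + 1/c)√(n W_n), which tends to 0 and depends on x
only through c. -/

theorem laguerrePoly_zero_coeff (n k : ℕ) :
    (laguerrePoly 0 n).coeff k = (-1) ^ k * (n.choose k : ℝ) / k.factorial := by
  simp only [laguerrePoly, finsetSum_coeff, coeff_C_mul, coeff_X_pow, mul_ite, mul_one, mul_zero,
    Finset.sum_ite_eq, Finset.mem_range, Nat.add_zero]
  split_ifs with h
  · rw [Nat.choose_symm (by omega)]
  · rw [Nat.choose_eq_zero_of_lt (by omega)]; simp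

/-- The Laguerre polynomials with parameter one, normalized to take the value one at zero. -/
noncomputable def normLaguerre (n : ℕ) : ℝ[X] := C (1 / ((n : ℝ) + 1)) * laguerrePoly 1 n

theorem normLaguerre_coeff (n k : ℕ) :
    (normLaguerre n).coeff k = (-1) ^ k * (n.choose k : ℝ) / (k + 1).factorial := by
  simp only [normLaguerre, laguerrePoly, finsetSum_coeff, coeff_C_mul, coeff_X_pow, mul_ite,
    mul_one, mul_zero, Finset.sum_ite_eq, Finset.mem_range]
  split_ifs with h
  · have h1 : (n + 1).choose (n - k) = (n + 1).choose (k + 1) := by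
      rw [← Nat.choose_symm (by omega : k + 1 ≤ n + 1)]; congr 1; omega
    have h2 : ((n : ℝ) + 1) * n.choose k = (n + 1).choose (k + 1) * (k + 1) := by
      exact_mod_cast Nat.add_one_mul_choose_eq n k
    rw [h1, Nat.factorial_succ]
    have h3 : ((k.factorial : ℕ) : ℝ) ≠ 0 := by positivity
    have h4 : (n : ℝ) + 1 ≠ 0 := by positivity
    push_cast
    field_simp
    linear_combination -h2
  · rw [Nat.choose_eq_zero_of_lt (by omega)]; simp

theorem laguerrePoly_one_eq (n : ℕ) : laguerrePoly 1 n = C ((n : ℝ) + 1) * normLaguerre n := by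
  have h4 : (n : ℝ) + 1 ≠ 0 := by positivity
  rw [normLaguerre, ← mul_assoc, ← C_mul, mul_one_div_cancel h4, C_1, one_mul]

theorem X_mul_normLaguerre (n : ℕ) :
    X * normLaguerre n = laguerrePoly 0 n - laguerrePoly 0 (n + 1) := by
  ext k
  rcases k with _ | k
  · simp [laguerrePoly_zero_coeff]
  · rw [coeff_X_mul, coeff_sub, normLaguerre_coeff, laguerrePoly_zero_coeff,
      laguerrePoly_zero_coeff, Nat.choose_succ_succ]
    push_cast
    ring

theorem derivative_laguerrePoly_zero (n : ℕ) :
    derivative (laguerrePoly 0 (n + 1)) = derivative (laguerrePoly 0 n) - laguerrePoly 0 n := by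
  ext k
  rw [coeff_sub, coeff_derivative, coeff_derivative, laguerrePoly_zero_coeff,
    laguerrePoly_zero_coeff, laguerrePoly_zero_coeff, Nat.choose_succ_succ, Nat.factorial_succ]
  have h3 : ((k.factorial : ℕ) : ℝ) ≠ 0 := by positivity
  push_cast
  field_simp
  ring

/-- The three-term recurrence in divergence form, a discrete Sturm-Liouville equation; this form is
what makes summation by parts possible in `energy_identity`. -/
theorem normLaguerre_recurrence (n : ℕ) :
    C (((n : ℝ) + 1) * (n + 2)) * (normLaguerre (n + 1) - normLaguerre n) =
      C ((n : ℝ) * (n + 1)) * (normLaguerre n - normLaguerre (n - 1)) -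
        C ((n : ℝ) + 1) * (X * normLaguerre n) := by
  ext k
  simp only [coeff_C_mul, coeff_sub]
  rcases k with _ | k
  · simp [normLaguerre_coeff]
  · rw [coeff_X_mul]
    simp only [normLaguerre_coeff]
    rw [Nat.choose_succ_succ, Nat.factorial_succ (k + 1)]
    have h3 : (((k + 1).factorial : ℕ) : ℝ) ≠ 0 := by positivity
    -- At n = 0 the truncated index n - 1 is harmless, since its coefficient n vanishes.
    rcases n with _ | n
    · rcases k with _ | k <;> norm_num
    · have h2 : (n.choose k : ℝ) * (n + 1) = (n + 1).choose k * (n + 1 - k) := by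
        rcases le_or_gt k (n + 1) with hk | hk
        · rw [← Nat.cast_add_one n, ← Nat.cast_sub hk]
          exact_mod_cast Nat.choose_mul_succ_eq n k
        · rw [Nat.choose_eq_zero_of_lt hk, Nat.choose_eq_zero_of_lt (by omega)]; simp
      rw [Nat.add_sub_cancel, Nat.choose_succ_succ n k, Nat.succ_eq_add_one]
      push_cast
      field_simp
      linear_combination (-1) ^ k * h2

theorem degree_laguerrePoly_zero_le (n : ℕ) : (laguerrePoly 0 n).natDegree ≤ n := by
  rw [natDegree_le_iff_coeff_eq_zero]
  intro k hk
  rw [laguerrePoly_zero_coeff, Nat.choose_eq_zero_of_lt hk]; simp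

theorem natDegree_normLaguerre_le (n : ℕ) : (normLaguerre n).natDegree ≤ n := by
  rw [natDegree_le_iff_coeff_eq_zero]
  intro k hk
  rw [normLaguerre_coeff, Nat.choose_eq_zero_of_lt hk]; simp

/-! ### The moment functional of the weight `e^{-x}` on the half line -/

/-- The linear functional `X ^ k ↦ k!`. -/
noncomputable def moment : ℝ[X] →ₗ[ℝ] ℝ :=
  Polynomial.lsum fun k => (k.factorial : ℝ) • LinearMap.id

theorem moment_monomial (k : ℕ) (a : ℝ) : moment (monomial k a) = k.factorial * a := by
  simp [moment]

theorem integral_eval_mul_exp (p : ℝ[X]) :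
    MeasureTheory.IntegrableOn (fun x => p.eval x * Real.exp (-x)) (Set.Ioi 0) ∧
      ∫ x in Set.Ioi (0 : ℝ), p.eval x * Real.exp (-x) = moment p := by
  induction p using Polynomial.induction_on' with
  | add p q hp hq =>
    simp only [eval_add, add_mul, map_add]
    exact ⟨hp.1.add hq.1, by rw [MeasureTheory.integral_add hp.1 hq.1, hp.2, hq.2]⟩
  | monomial k a =>
    have h1 := Real.GammaIntegral_convergent (s := k + 1) (by positivity)
    have h2 := Real.Gamma_eq_integral (s := k + 1) (by positivity)
    rw [Real.Gamma_nat_eq_factorial] at h2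
    have h3 : (fun x : ℝ => (monomial k a).eval x * Real.exp (-x)) =
        fun x => a * (Real.exp (-x) * x ^ ((k : ℝ) + 1 - 1)) := by
      funext x
      simp only [eval_monomial, add_sub_cancel_right, Real.rpow_natCast]
      ring
    rw [h3, moment_monomial]
    refine ⟨h1.const_mul a, ?_⟩
    rw [MeasureTheory.integral_const_mul, ← h2, mul_comm]

theorem moment_derivative (p : ℝ[X]) : moment (derivative p) = moment p - p.coeff 0 := by
  induction p using Polynomial.induction_on' with
  | add p q hp hq => simp only [map_add, coeff_add, hp, hq]; ring
  | monomial k a =>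
    rw [derivative_monomial, moment_monomial, moment_monomial]
    rcases k with _ | k
    · simp
    · simp only [Nat.add_sub_cancel, Nat.factorial_succ, coeff_monomial]
      push_cast
      simp
      ring

/-- Integration by parts: the derivative of L_{n+1} - L_n is -L_n, and there is no boundary term
because both polynomials equal 1 at 0. Each use differentiates q once, so orthogonality follows by
induction on the degree. -/
theorem moment_laguerrePoly_succ_mul (n : ℕ) (q : ℝ[X]) :
    moment (laguerrePoly 0 (n + 1) * q) =
      moment (laguerrePoly 0 (n + 1) * derivative q) -
        moment (laguerrePoly 0 n * derivative q) := by
  have h := moment_derivative ((laguerrePoly 0 (n + 1) - laguerrePoly 0 n) * q)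
  have h0 : ((laguerrePoly 0 (n + 1) - laguerrePoly 0 n) * q).coeff 0 = 0 := by
    simp [mul_coeff_zero, laguerrePoly_zero_coeff]
  rw [h0, derivative_mul, derivative_sub, derivative_laguerrePoly_zero] at h
  simp only [sub_mul, map_add, map_sub] at h
  linarith

theorem moment_laguerrePoly_mul_eq_zero (d : ℕ) :
    ∀ (n : ℕ) (q : ℝ[X]), q.natDegree ≤ d → d < n → moment (laguerrePoly 0 n * q) = 0 := by
  induction d with
  | zero =>
    intro n q hq hn
    obtain ⟨n, rfl⟩ := Nat.exists_eq_succ_of_ne_zero hn.ne'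
    rw [moment_laguerrePoly_succ_mul, natDegree_eq_zero.mp (Nat.le_zero.mp hq) |>.choose_spec.symm]
    simp
  | succ d ih =>
    intro n q hq hn
    obtain ⟨n, rfl⟩ := Nat.exists_eq_succ_of_ne_zero (Nat.zero_lt_of_lt hn).ne'
    have h := natDegree_derivative_le q
    rw [moment_laguerrePoly_succ_mul, ih _ _ (by omega) (by omega), ih _ _ (by omega) (by omega),
      sub_zero]

theorem moment_laguerrePoly_mul_of_le (n : ℕ) :
    ∀ q : ℝ[X], q.natDegree ≤ n →
      moment (laguerrePoly 0 n * q) = (-1) ^ n * n.factorial * q.coeff n := by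
  induction n with
  | zero =>
    intro q hq
    obtain ⟨a, rfl⟩ := natDegree_eq_zero.mp (Nat.le_zero.mp hq)
    have h : laguerrePoly 0 0 = 1 := by simp [laguerrePoly]
    rw [h, one_mul, ← monomial_zero_left, moment_monomial]
    simp
  | succ n ih =>
    intro q hq
    have h := natDegree_derivative_le q
    rw [moment_laguerrePoly_succ_mul,
      moment_laguerrePoly_mul_eq_zero n (n + 1) _ (by omega) (by omega), ih _ (by omega),
      coeff_derivative, Nat.factorial_succ]
    push_cast
    ring

theorem moment_laguerrePoly_mul_self (n : ℕ) :
    moment (laguerrePoly 0 n * laguerrePoly 0 n) = 1 := by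
  rw [moment_laguerrePoly_mul_of_le n _ (degree_laguerrePoly_zero_le n), laguerrePoly_zero_coeff,
    Nat.choose_self]
  have h3 : ((n.factorial : ℕ) : ℝ) ≠ 0 := by positivity
  field_simp
  rw [Nat.cast_one, mul_one, ← pow_mul, mul_comm, pow_mul]; simp

theorem moment_laguerrePoly_mul_of_lt {m n : ℕ} (h : m < n) :
    moment (laguerrePoly 0 n * laguerrePoly 0 m) = 0 :=
  moment_laguerrePoly_mul_eq_zero m n _ (degree_laguerrePoly_zero_le m) h

/-! ### The energy identity for solutions of the recurrence -/

section Energy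

variable {z : ℂ} {b : ℕ → ℂ}

/-- The Dirichlet part of the energy. -/
noncomputable def dirichletEnergy (b : ℕ → ℂ) (n : ℕ) : ℝ :=
  ∑ k ∈ Finset.range n, ((k : ℝ) + 1) * (k + 2) * ‖b (k + 1) - b k‖ ^ 2

/-- The mass part of the energy. -/
noncomputable def massEnergy (b : ℕ → ℂ) (n : ℕ) : ℝ :=
  ∑ k ∈ Finset.range n, ((k : ℝ) + 1) * ‖b k‖ ^ 2

theorem dirichletEnergy_nonneg (b : ℕ → ℂ) (n : ℕ) : 0 ≤ dirichletEnergy b n :=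
  Finset.sum_nonneg fun k _ => by positivity

theorem massEnergy_pos (h0 : b 0 ≠ 0) (n : ℕ) : 0 < massEnergy b (n + 1) := by
  rw [massEnergy, Finset.sum_range_succ']
  have h1 : 0 < ‖b 0‖ := norm_pos_iff.mpr h0
  have h2 : 0 ≤ ∑ k ∈ Finset.range n, (((k + 1 : ℕ) : ℝ) + 1) * ‖b (k + 1)‖ ^ 2 :=
    Finset.sum_nonneg fun k _ => by positivity
  have : 0 < (((0 : ℕ) : ℝ) + 1) * ‖b 0‖ ^ 2 := by positivity
  linarith

/-- Summation by parts: each step adds (b_{n+1} - b_n) times the conjugate of the same difference to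
the Dirichlet part and b_n conj b_n to the mass part, so both parts are real and nonnegative. -/
theorem energy_identity
    (hb : ∀ n : ℕ, ((n : ℂ) + 1) * (n + 2) * (b (n + 1) - b n) =
      (n : ℂ) * (n + 1) * (b n - b (n - 1)) + (n + 1) * (z * b n)) (n : ℕ) :
    (n : ℂ) * (n + 1) * (b n - b (n - 1)) * conj (b n) =
      dirichletEnergy b n + z * massEnergy b n := by
  induction n with
  | zero => simp [dirichletEnergy, massEnergy]
  | succ n ih =>
    have h1 : (dirichletEnergy b (n + 1) : ℂ) = dirichletEnergy b n +
        ((n : ℂ) + 1) * (n + 2) * ((b (n + 1) - b n) * conj (b (n + 1) - b n)) := by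
      rw [Complex.mul_conj, Complex.normSq_eq_norm_sq, dirichletEnergy, Finset.sum_range_succ,
        ← dirichletEnergy]
      push_cast
      ring
    have h2 : (massEnergy b (n + 1) : ℂ) = massEnergy b n +
        ((n : ℂ) + 1) * (b n * conj (b n)) := by
      rw [Complex.mul_conj, Complex.normSq_eq_norm_sq, massEnergy, Finset.sum_range_succ,
        ← massEnergy]
      push_cast
      ring
    rw [h1, h2, map_sub, Nat.add_sub_cancel]
    push_cast
    linear_combination ih + conj (b n) * hb n

theorem ne_zero_of_recurrence
    (hb : ∀ n : ℕ, ((n : ℂ) + 1) * (n + 2) * (b (n + 1) - b n) =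
      (n : ℂ) * (n + 1) * (b n - b (n - 1)) + (n + 1) * (z * b n))
    (h0 : b 0 ≠ 0) (hz : ∀ t : ℝ, 0 ≤ t → z + t ≠ 0) (n : ℕ) : b n ≠ 0 := by
  rcases n with _ | n
  · exact h0
  intro h
  have h1 := energy_identity hb (n + 1)
  have hB := massEnergy_pos h0 n
  rw [h, map_zero, mul_zero] at h1
  -- If b_{n+1} = 0, the energy identity reads A + zB = 0, which puts -z = A/B on the closed half
  -- line.
  refine hz (dirichletEnergy b (n + 1) / massEnergy b (n + 1))
    (div_nonneg (dirichletEnergy_nonneg _ _) hB.le) ?_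
  have hB' : (massEnergy b (n + 1) : ℂ) ≠ 0 := by exact_mod_cast hB.ne'
  push_cast
  field_simp
  linear_combination -h1

/-- The cone condition at t = A/B prevents cancellation in A + zB, so A is at most (1 + 1/c) times
the boundary term N d |b_n|. As A also contains the term N d², this bounds d by (1 + 1/c)|b_n|, and
substituting back removes d. -/
theorem dirichletEnergy_le
    (hb : ∀ n : ℕ, ((n : ℂ) + 1) * (n + 2) * (b (n + 1) - b n) =
      (n : ℂ) * (n + 1) * (b n - b (n - 1)) + (n + 1) * (z * b n))
    (h0 : b 0 ≠ 0) {c : ℝ} (hc : 0 < c) (hz : ∀ t : ℝ, 0 ≤ t → c * ‖z‖ ≤ ‖z + t‖) (n : ℕ) :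
    dirichletEnergy b n ≤ (1 + 1 / c) ^ 2 * (n * (n + 1)) * ‖b n‖ ^ 2 := by
  rcases n with _ | n
  · simp [dirichletEnergy]
  set A := dirichletEnergy b (n + 1)
  set B := massEnergy b (n + 1)
  have hA : 0 ≤ A := dirichletEnergy_nonneg _ _
  have hB : 0 < B := massEnergy_pos h0 n
  have hB' : (B : ℂ) ≠ 0 := by exact_mod_cast hB.ne'
  set d := ‖b (n + 1) - b n‖
  set N : ℝ := ((n : ℝ) + 1) * (n + 2) with hN
  have hNpos : 0 < N := by positivity
  have h1 := congrArg norm (energy_identity hb (n + 1))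
  have h2 : ‖(A : ℂ) + z * B‖ = N * d * ‖b (n + 1)‖ := by
    rw [← h1, Nat.add_sub_cancel, norm_mul, norm_mul, RCLike.norm_conj]
    congr 2
    rw [hN, ← Complex.norm_of_nonneg (by positivity : 0 ≤ ((n : ℝ) + 1) * (n + 2))]
    congr 1
    push_cast
    ring
  have h3 : c * (‖z‖ * B) ≤ ‖(A : ℂ) + z * B‖ := by
    have h4 : (A : ℂ) + z * B = (z + ((A / B : ℝ) : ℂ)) * B := by
      push_cast
      field_simp
      ring
    rw [h4, norm_mul, Complex.norm_of_nonneg hB.le, ← mul_assoc]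
    exact mul_le_mul_of_nonneg_right (hz _ (div_nonneg hA hB.le)) hB.le
  have h5 : A ≤ ‖(A : ℂ) + z * B‖ + ‖z‖ * B := by
    have h6 := norm_sub_le ((A : ℂ) + z * B) (z * B)
    rwa [add_sub_cancel_right, norm_mul, Complex.norm_of_nonneg hB.le,
      Complex.norm_of_nonneg hA] at h6
  have h7 : A ≤ (1 + 1 / c) * (N * d * ‖b (n + 1)‖) := by
    have : ‖z‖ * B ≤ 1 / c * (N * d * ‖b (n + 1)‖) := by
      rw [div_mul_eq_mul_div, one_mul, le_div_iff₀ hc, ← h2]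
      linarith
    rw [h2] at h5
    linarith
  have h8 : N * d ^ 2 ≤ A := by
    simp only [A, dirichletEnergy, Finset.sum_range_succ]
    have : 0 ≤ ∑ k ∈ Finset.range n, ((k : ℝ) + 1) * (k + 2) * ‖b (k + 1) - b k‖ ^ 2 :=
      Finset.sum_nonneg fun k _ => by positivity
    linarith
  have hd : 0 ≤ d := norm_nonneg _
  have hC : 0 < 1 + 1 / c := by positivity
  have h9 : d ≤ (1 + 1 / c) * ‖b (n + 1)‖ := by
    rcases hd.eq_or_lt with h | h
    · rw [← h]; positivity
    · have : (N * d) * d ≤ (N * d) * ((1 + 1 / c) * ‖b (n + 1)‖) := by nlinarith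
      exact le_of_mul_le_mul_left this (by positivity)
  calc A ≤ (1 + 1 / c) * (N * d * ‖b (n + 1)‖) := h7
    _ ≤ (1 + 1 / c) * (N * ((1 + 1 / c) * ‖b (n + 1)‖) * ‖b (n + 1)‖) := by gcongr
    _ = _ := by rw [hN]; push_cast; ring

end Energy

/-! ### The scalar recurrence of the Gram-Schmidt norms -/

/-- Four times the squared Sobolev norms of the orthogonalized functions. -/
noncomputable def sobolevNormSeq (lam : ℝ) : ℕ → ℝ
  | 0 => 2 + 4 * lam
  | n + 1 => 2 + 4 * lam / (n + 2) - 1 / sobolevNormSeq lam n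

/-- Heuristically r_n follows the fixed point of r = 2 + 4 lam/n - 1/r, which is about 1 +
2√(lam/n). The smaller constant √(2 lam) leaves room for the induction to absorb the change from
√(n+1) to √(n+2). -/
theorem one_add_le_sobolevNormSeq {lam : ℝ} (hlam : 0 < lam) (n : ℕ) :
    1 + √(2 * lam) / √((n : ℝ) + 1) ≤ sobolevNormSeq lam n := by
  obtain ⟨c, hc⟩ : ∃ c, c = √(2 * lam) := ⟨_, rfl⟩
  have hc0 : 0 < c := by rw [hc]; positivity
  have hcc : 2 * lam = c ^ 2 := by rw [hc, Real.sq_sqrt (by positivity)]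
  rw [← hc]
  induction n with
  | zero =>
    simp only [sobolevNormSeq, Nat.cast_zero, zero_add, Real.sqrt_one, div_one]
    nlinarith [sq_nonneg (c - 1)]
  | succ n ih =>
    rw [sobolevNormSeq]
    obtain ⟨s, hs⟩ : ∃ s, s = √((n : ℝ) + 1) := ⟨_, rfl⟩
    obtain ⟨t, ht⟩ : ∃ t, t = √((n : ℝ) + 1 + 1) := ⟨_, rfl⟩
    have hs0 : 0 < s := by rw [hs]; positivity
    have ht0 : 0 < t := by rw [ht]; positivity
    have hss : s ^ 2 = n + 1 := by rw [hs, Real.sq_sqrt (by positivity)]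
    have htt : t ^ 2 = n + 2 := by rw [ht, Real.sq_sqrt (by positivity)]; ring
    rw [← hs] at ih
    push_cast
    rw [← ht, ← htt]
    have h1 : 1 / sobolevNormSeq lam n ≤ 1 / (1 + c / s) :=
      one_div_le_one_div_of_le (by positivity) ih
    have h2 : 4 * lam = 2 * c ^ 2 := by linarith
    have hst : s ≤ t := by nlinarith
    have hts : t ≤ 2 * s := by
      have : (0 : ℝ) ≤ n := n.cast_nonneg
      nlinarith
    have h3 : c / t + 1 / (1 + c / s) ≤ 1 + 2 * c ^ 2 / t ^ 2 := by
      have e : 1 + 2 * c ^ 2 / t ^ 2 - (c / t + 1 / (1 + c / s)) =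
          c * (t * (t - s) + c * (2 * s - t) + 2 * c ^ 2) / (t ^ 2 * (s + c)) := by
        field_simp
        ring
      have : 0 ≤ 1 + 2 * c ^ 2 / t ^ 2 - (c / t + 1 / (1 + c / s)) := by
        rw [e]
        have := sub_nonneg.mpr hst
        have := sub_nonneg.mpr hts
        positivity
      linarith
    rw [h2]
    linarith

theorem one_lt_sobolevNormSeq {lam : ℝ} (hlam : 0 < lam) (n : ℕ) : 1 < sobolevNormSeq lam n := by
  have h := one_add_le_sobolevNormSeq hlam n
  have : 0 < √(2 * lam) / √((n : ℝ) + 1) := by positivity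
  linarith

/-- The constants that control the remainder in the summation by parts. -/
noncomputable def dampedSum (r : ℕ → ℝ) : ℕ → ℝ
  | 0 => 0
  | n + 1 => (1 / r n) ^ 2 * (dampedSum r n + 1 / (((n : ℝ) + 1) * (n + 2)))

theorem dampedSum_nonneg (r : ℕ → ℝ) (n : ℕ) : 0 ≤ dampedSum r n := by
  induction n with
  | zero => simp [dampedSum]
  | succ n ih => rw [dampedSum]; positivity

/-- Solutions of `T (n + 1) = b (n + 1) - T n / r n` are controlled by the Dirichlet energy. -/
theorem norm_le_of_alternating_recurrence {r : ℕ → ℝ} (hr : ∀ n, 1 < r n) {b T : ℕ → ℂ}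
    (hT0 : T 0 = b 0) (hT : ∀ n, T (n + 1) = b (n + 1) - ((1 / r n : ℝ) : ℂ) * T n) (n : ℕ) :
    ‖T n‖ ≤ ‖b n‖ + √(dirichletEnergy b n * dampedSum r n) := by
  -- The main part obeys g_{n+1} = 1 - g_n/r_n, which stays in [0, 1] because r_n > 1. The remainder
  -- picks up g_n (b_{n+1} - b_n) and is then multiplied by 1/r_n up to sign.
  have key : ∃ g : ℝ, 0 ≤ g ∧ g ≤ 1 ∧
      ‖T n - g * b n‖ ^ 2 ≤ dirichletEnergy b n * dampedSum r n := by
    induction n with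
    | zero => exact ⟨1, by norm_num, le_rfl, by simp [hT0, dampedSum]⟩
    | succ n ih =>
      obtain ⟨g, hg0, hg1, hg⟩ := ih
      have hr0 : 0 < r n := by linarith [hr n]
      obtain ⟨q, hq⟩ : ∃ q, q = 1 / r n := ⟨_, rfl⟩
      have hq0 : 0 ≤ q := by rw [hq]; positivity
      have hq1 : q ≤ 1 := by rw [hq, div_le_one hr0]; exact (hr n).le
      have hqg : q * g ≤ 1 := mul_le_one₀ hq1 hg0 hg1
      refine ⟨1 - q * g, by linarith, by nlinarith, ?_⟩
      have e : T (n + 1) - ((1 - q * g : ℝ) : ℂ) * b (n + 1) =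
          (q : ℂ) * (g * (b (n + 1) - b n) - (T n - g * b n)) := by
        rw [hT, ← hq]
        push_cast
        ring
      obtain ⟨d, hd⟩ : ∃ d, d = ‖b (n + 1) - b n‖ := ⟨_, rfl⟩
      obtain ⟨R, hR⟩ : ∃ R, R = ‖T n - g * b n‖ := ⟨_, rfl⟩
      have hd0 : 0 ≤ d := hd ▸ norm_nonneg _
      have hR0 : 0 ≤ R := hR ▸ norm_nonneg _
      have h1 : ‖T (n + 1) - ((1 - q * g : ℝ) : ℂ) * b (n + 1)‖ ≤ q * (d + R) := by
        rw [e, norm_mul, Complex.norm_of_nonneg hq0]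
        refine mul_le_mul_of_nonneg_left ((norm_sub_le _ _).trans ?_) hq0
        rw [norm_mul, Complex.norm_of_nonneg hg0, ← hd, ← hR]
        nlinarith
      refine (pow_le_pow_left₀ (norm_nonneg _) h1 2).trans ?_
      rw [dampedSum, dirichletEnergy, Finset.sum_range_succ, ← dirichletEnergy, ← hq, ← hd,
        mul_pow, mul_left_comm]
      refine mul_le_mul_of_nonneg_left ?_ (sq_nonneg q)
      rw [← hR] at hg
      obtain ⟨N, hN⟩ : ∃ N : ℝ, N = ((n : ℝ) + 1) * (n + 2) := ⟨_, rfl⟩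
      have hN0 : 0 < N := by rw [hN]; positivity
      rw [← hN]
      have hA := dirichletEnergy_nonneg b n
      have hW := dampedSum_nonneg r n
      set A := dirichletEnergy b n
      set W := dampedSum r n
      have e2 : (A + N * d ^ 2) * (W + 1 / N) = A * W + d ^ 2 + (A / N + N * d ^ 2 * W) := by
        field_simp
        ring
      -- With R² ≤ AW this is the arithmetic-geometric mean inequality; it yields the Cauchy-Schwarz
      -- bound (d + R)² ≤ (A + N d²)(W + 1/N).
      have h3 : 2 * (d * R) ≤ A / N + N * d ^ 2 * W := by
        have h4 : 0 ≤ A / N + N * d ^ 2 * W := by positivity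
        refine (pow_le_pow_iff_left₀ (by positivity) h4 two_ne_zero).mp ?_
        have h5 : (A / N) * (N * d ^ 2 * W) = d ^ 2 * (A * W) := by
          field_simp
        nlinarith [sq_nonneg (A / N - N * d ^ 2 * W), mul_le_mul_of_nonneg_left hg (sq_nonneg d)]
      rw [e2]
      nlinarith
  obtain ⟨g, hg0, hg1, hg⟩ := key
  have h1 : ‖T n - g * b n‖ ≤ √(dirichletEnergy b n * dampedSum r n) := Real.le_sqrt_of_sq_le hg
  have h2 : ‖T n‖ ≤ ‖(g : ℂ) * b n‖ + ‖T n - g * b n‖ := by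
    have := norm_add_le ((g : ℂ) * b n) (T n - g * b n)
    rwa [add_sub_cancel] at this
  rw [norm_mul, Complex.norm_of_nonneg hg0] at h2
  nlinarith [norm_nonneg (b n)]

/-- With s = √(n+1), the damping removes about 2cM/s⁴ from the bound M/s³. This must cover the new
term 1/s⁴ and the decrease of M/s³ itself, which has only order M/s⁵. Hence M ≥ 3/c and a start at
cs ≥ 2; the maximum in the choice of M settles the base case. -/
theorem exists_dampedSum_le {r : ℕ → ℝ} {c : ℝ} (hc : 0 < c)
    (hr : ∀ n : ℕ, 1 + c / √((n : ℝ) + 1) ≤ r n) :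
    ∃ (M : ℝ) (N : ℕ), ∀ n, N ≤ n → dampedSum r n ≤ M / √((n : ℝ) + 1) ^ 3 := by
  obtain ⟨N, hN⟩ := exists_nat_ge ((2 / c) ^ 2)
  obtain ⟨M, hM⟩ : ∃ M, M = max (3 / c) (dampedSum r N * √((N : ℝ) + 1) ^ 3) := ⟨_, rfl⟩
  have hM1 : 3 ≤ M * c := by rw [← div_le_iff₀ hc, hM]; exact le_max_left _ _
  have hM0 : 0 < M := by by_contra! h; nlinarith
  refine ⟨M, N, fun n hn => ?_⟩
  induction n, hn using Nat.le_induction with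
  | base => rw [le_div_iff₀ (by positivity), hM]; exact le_max_right _ _
  | succ n hn ih =>
    have hrn := hr n
    obtain ⟨s, hs⟩ : ∃ s, s = √((n : ℝ) + 1) := ⟨_, rfl⟩
    obtain ⟨t, ht⟩ : ∃ t, t = √((n : ℝ) + 1 + 1) := ⟨_, rfl⟩
    have hs0 : 0 < s := by rw [hs]; positivity
    have ht0 : 0 < t := by rw [ht]; positivity
    have hss : s ^ 2 = n + 1 := by rw [hs, Real.sq_sqrt (by positivity)]
    have htt : t ^ 2 = s ^ 2 + 1 := by rw [ht, Real.sq_sqrt (by positivity), hss]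
    have hs1 : 1 ≤ s := by
      have : (0 : ℝ) ≤ n := n.cast_nonneg
      nlinarith
    have hcs : 2 ≤ c * s := by
      rw [← div_le_iff₀' hc]
      refine (pow_le_pow_iff_left₀ (by positivity) hs0.le two_ne_zero).mp ?_
      have : (N : ℝ) ≤ n := by exact_mod_cast hn
      linarith
    rw [dampedSum]
    push_cast
    rw [← hs] at ih hrn
    rw [← ht]
    have h1 : (1 / r n) ^ 2 ≤ 1 / (1 + 2 * c / s) := by
      have h0 : 0 < 1 + c / s := by positivity
      rw [one_div_pow]
      refine one_div_le_one_div_of_le (by positivity) ?_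
      have h2 : (1 + c / s) ^ 2 ≤ r n ^ 2 := pow_le_pow_left₀ h0.le hrn 2
      have h3 : 1 + 2 * c / s ≤ (1 + c / s) ^ 2 := by
        have e : (1 + c / s) ^ 2 = 1 + 2 * c / s + (c / s) ^ 2 := by ring
        rw [e]
        linarith [sq_nonneg (c / s)]
      linarith
    have h2 : 1 / (((n : ℝ) + 1) * (n + 2)) ≤ 1 / s ^ 4 := by
      refine one_div_le_one_div_of_le (by positivity) ?_
      have e : s ^ 4 = ((n : ℝ) + 1) * (n + 1) := by rw [← hss]; ring
      rw [e]
      gcongr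
      norm_num
    have ht1 : t ≤ s + 1 / (2 * s) := by
      refine (pow_le_pow_iff_left₀ ht0.le (by positivity) two_ne_zero).mp ?_
      have e : (s + 1 / (2 * s)) ^ 2 = s ^ 2 + 1 + (1 / (2 * s)) ^ 2 := by
        field_simp
        ring
      rw [e, htt]
      linarith [sq_nonneg (1 / (2 * s))]
    have ht2 : s * t ≤ s ^ 2 + 1 / 2 := by
      calc s * t ≤ s * (s + 1 / (2 * s)) := mul_le_mul_of_nonneg_left ht1 hs0.le
        _ = _ := by field_simp
    have hn0 := dampedSum_nonneg r n
    calc (1 / r n) ^ 2 * (dampedSum r n + 1 / (((n : ℝ) + 1) * (n + 2)))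
        ≤ 1 / (1 + 2 * c / s) * (M / s ^ 3 + 1 / s ^ 4) := by gcongr
      _ = (M * s + 1) / (s ^ 3 * (s + 2 * c)) := by field_simp
      _ ≤ M / t ^ 3 := by
        rw [div_le_div_iff₀ (by positivity) (by positivity)]
        have e1 : (M * s + 1) * t ^ 3 = (M * s + 1) * (s ^ 2 + 1) * t := by rw [← htt]; ring
        rw [e1]
        have h5 : (M * s + 1) * (s ^ 2 + 1) * (s * t) ≤
            (M * s + 1) * (s ^ 2 + 1) * (s ^ 2 + 1 / 2) :=
          mul_le_mul_of_nonneg_left ht2 (by positivity)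
        have h6 : (M * s + 1) * (s ^ 2 + 1) * (s ^ 2 + 1 / 2) ≤ M * (s ^ 4 * (s + 2 * c)) := by
          have a1 : 4 * s ^ 4 ≤ 2 * (M * c * s ^ 4) - 2 * s ^ 4 := by
            nlinarith [pow_pos hs0 4]
          have a2 : M * s ^ 3 * 2 ≤ M * s ^ 3 * (c * s) :=
            mul_le_mul_of_nonneg_left hcs (by positivity)
          have a3 : M * s * 1 ≤ M * s * s ^ 2 :=
            mul_le_mul_of_nonneg_left (one_le_pow₀ hs1) (by positivity)
          have a4 : (1 : ℝ) ≤ s ^ 2 := one_le_pow₀ hs1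
          have a5 : s ^ 2 * 1 ≤ s ^ 2 * s ^ 2 := mul_le_mul_of_nonneg_left a4 (by positivity)
          nlinarith
        have h7 : s * ((M * s + 1) * (s ^ 2 + 1) * t) ≤ s * (M * (s ^ 3 * (s + 2 * c))) := by
          nlinarith
        exact le_of_mul_le_mul_left h7 hs0

theorem tendsto_mul_dampedSum {r : ℕ → ℝ} {c : ℝ} (hc : 0 < c)
    (hr : ∀ n : ℕ, 1 + c / √((n : ℝ) + 1) ≤ r n) :
    Filter.Tendsto (fun n : ℕ => (n : ℝ) * dampedSum r n) Filter.atTop (nhds 0) := by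
  obtain ⟨M, N, h⟩ := exists_dampedSum_le hc hr
  have hs : Filter.Tendsto (fun n : ℕ => √((n : ℝ) + 1)) Filter.atTop Filter.atTop :=
    Real.tendsto_sqrt_atTop.comp
      (Filter.tendsto_atTop_add_const_right _ _ tendsto_natCast_atTop_atTop)
  refine squeeze_zero' (Filter.Eventually.of_forall fun n => ?_) ?_ (hs.const_div_atTop M)
  · exact mul_nonneg n.cast_nonneg (dampedSum_nonneg r n)
  · filter_upwards [Filter.eventually_ge_atTop N] with n hn
    have h1 := h n hn
    have h2 : 0 < √((n : ℝ) + 1) := by positivity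
    have h3 : √((n : ℝ) + 1) ^ 2 = n + 1 := Real.sq_sqrt (by positivity)
    calc (n : ℝ) * dampedSum r n ≤ √((n : ℝ) + 1) ^ 2 * dampedSum r n := by
          rw [h3]
          exact mul_le_mul_of_nonneg_right (by linarith) (dampedSum_nonneg r n)
      _ ≤ √((n : ℝ) + 1) ^ 2 * (M / √((n : ℝ) + 1) ^ 3) := by gcongr
      _ = M / √((n : ℝ) + 1) := by field_simp

/-! ### The Sobolev form on polynomials -/

/-- The polynomial factor of the derivative of `p(x) x e^{-x/2}`. -/
noncomputable def testDeriv (p : ℝ[X]) : ℝ[X] := derivative (X * p) - (1 / 2 : ℝ) • (X * p)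

theorem deriv_testFun (p : ℝ[X]) (x : ℝ) :
    deriv (testFun p) x = (testDeriv p).eval x * Real.exp (-x / 2) := by
  have h1 : HasDerivAt (fun x => (X * p).eval x) ((derivative (X * p)).eval x) x :=
    (X * p).hasDerivAt x
  have h2 : HasDerivAt (fun x : ℝ => Real.exp (-x / 2)) (Real.exp (-x / 2) * (-1 / 2)) x :=
    ((hasDerivAt_neg x).div_const 2).exp
  have h3 : testFun p = fun x => (X * p).eval x * Real.exp (-x / 2) := by
    funext x
    simp only [testFun, eval_mul, eval_X]
    ring
  rw [h3]
  refine (h1.mul h2).deriv.trans ?_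
  simp only [testDeriv, eval_sub, eval_smul, smul_eq_mul]
  ring

/-- The Sobolev inner product of the functions `p(x) x e^{-x/2}`, as a bilinear form in `p`. -/
noncomputable def sobolevForm (lam : ℝ) : LinearMap.BilinForm ℝ ℝ[X] :=
  LinearMap.mk₂ ℝ
    (fun p q => lam * moment (X * p * q) + moment (testDeriv p * testDeriv q))
    (fun p p' q => by
      have h : testDeriv (p + p') = testDeriv p + testDeriv p' := by
        simp only [testDeriv, mul_add, derivative_add, smul_add]; ring
      simp only [h, mul_add, add_mul, map_add]; ring)
    (fun a p q => by
      have h : testDeriv (a • p) = a • testDeriv p := by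
        simp only [testDeriv, mul_smul_comm, derivative_smul, smul_sub, smul_comm a]
      simp only [h, mul_smul_comm, smul_mul_assoc, map_smul, smul_eq_mul]; ring)
    (fun p q q' => by
      have h : testDeriv (q + q') = testDeriv q + testDeriv q' := by
        simp only [testDeriv, mul_add, derivative_add, smul_add]; ring
      simp only [h, mul_add, map_add]; ring)
    (fun a p q => by
      have h : testDeriv (a • q) = a • testDeriv q := by
        simp only [testDeriv, mul_smul_comm, derivative_smul, smul_sub, smul_comm a]
      simp only [h, mul_smul_comm, map_smul, smul_eq_mul]; ring)

theorem sobolevForm_apply (lam : ℝ) (p q : ℝ[X]) :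
    sobolevForm lam p q = lam * moment (X * p * q) + moment (testDeriv p * testDeriv q) := rfl

theorem sobolevForm_comm (lam : ℝ) (p q : ℝ[X]) : sobolevForm lam p q = sobolevForm lam q p := by
  rw [sobolevForm_apply, sobolevForm_apply, mul_right_comm, mul_comm (testDeriv p)]

theorem sobolevInner_testFun (lam : ℝ) (p q : ℝ[X]) :
    sobolevInner lam (testFun p) (testFun q) = sobolevForm lam p q := by
  have he : ∀ x : ℝ, Real.exp (-x / 2) * Real.exp (-x / 2) = Real.exp (-x) := fun x => by
    rw [← Real.exp_add]; ring_nf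
  rw [sobolevInner, sobolevForm_apply, ← (integral_eval_mul_exp (X * p * q)).2,
    ← (integral_eval_mul_exp (testDeriv p * testDeriv q)).2]
  congr 2
  · refine MeasureTheory.setIntegral_congr_fun measurableSet_Ioi fun x hx => ?_
    have hx0 : x ≠ 0 := (Set.mem_Ioi.mp hx).ne'
    simp only [testFun, eval_mul, eval_X, ← he]
    field_simp
  · funext x
    rw [deriv_testFun, deriv_testFun, eval_mul, ← he]
    ring

/-- Together with `X_mul_normLaguerre` this makes the Gram matrix tridiagonal: only the
`laguerrePoly 0` polynomials of indices n and n+1 occur, so indices two or more apart do not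
interact. -/
theorem testDeriv_normLaguerre (n : ℕ) :
    testDeriv (normLaguerre n) = (1 / 2 : ℝ) • (laguerrePoly 0 n + laguerrePoly 0 (n + 1)) := by
  rw [testDeriv, X_mul_normLaguerre, derivative_sub, derivative_laguerrePoly_zero, smul_sub,
    smul_add]
  have h : laguerrePoly 0 n = (1 / 2 : ℝ) • laguerrePoly 0 n + (1 / 2 : ℝ) • laguerrePoly 0 n := by
    rw [← add_smul]; norm_num
  linear_combination h

theorem sobolevForm_normLaguerre_self (lam : ℝ) (n : ℕ) :
    sobolevForm lam (normLaguerre n) (normLaguerre n) = lam / (n + 1) + 1 / 2 := by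
  have h1 : moment (laguerrePoly 0 n * normLaguerre n) = 1 / ((n : ℝ) + 1) := by
    rw [moment_laguerrePoly_mul_of_le n _ (natDegree_normLaguerre_le n), normLaguerre_coeff,
      Nat.choose_self, Nat.factorial_succ]
    have h3 : ((n.factorial : ℕ) : ℝ) ≠ 0 := by positivity
    push_cast
    field_simp
    rw [← pow_mul, mul_comm, pow_mul]; simp
  rw [sobolevForm_apply, X_mul_normLaguerre, testDeriv_normLaguerre]
  simp only [sub_mul, add_mul, mul_add, map_sub, map_add, smul_mul_assoc, mul_smul_comm, map_smul,
    smul_eq_mul]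
  rw [h1, moment_laguerrePoly_mul_eq_zero n (n + 1) _ (natDegree_normLaguerre_le n) n.lt_succ_self,
    moment_laguerrePoly_mul_self, moment_laguerrePoly_mul_self,
    mul_comm (laguerrePoly 0 n) (laguerrePoly 0 (n + 1)),
    moment_laguerrePoly_mul_of_lt n.lt_succ_self]
  ring

theorem sobolevForm_normLaguerre_succ (lam : ℝ) (n : ℕ) :
    sobolevForm lam (normLaguerre (n + 1)) (normLaguerre n) = 1 / 4 := by
  rw [sobolevForm_apply, X_mul_normLaguerre, testDeriv_normLaguerre, testDeriv_normLaguerre]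
  simp only [sub_mul, add_mul, mul_add, map_sub, map_add, smul_mul_assoc, mul_smul_comm, map_smul,
    smul_eq_mul]
  rw [moment_laguerrePoly_mul_eq_zero n (n + 1) _ (natDegree_normLaguerre_le n) (by omega),
    moment_laguerrePoly_mul_eq_zero n (n + 1 + 1) _ (natDegree_normLaguerre_le n) (by omega),
    moment_laguerrePoly_mul_self, moment_laguerrePoly_mul_of_lt (by omega : n < n + 1),
    moment_laguerrePoly_mul_of_lt (by omega : n < n + 1 + 1),
    moment_laguerrePoly_mul_of_lt (by omega : n + 1 < n + 1 + 1)]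
  ring

theorem sobolevForm_normLaguerre_of_lt (lam : ℝ) {m n : ℕ} (h : m + 2 ≤ n) :
    sobolevForm lam (normLaguerre n) (normLaguerre m) = 0 := by
  rw [sobolevForm_apply, X_mul_normLaguerre, testDeriv_normLaguerre, testDeriv_normLaguerre]
  simp only [sub_mul, add_mul, mul_add, map_sub, map_add, smul_mul_assoc, mul_smul_comm, map_smul,
    smul_eq_mul]
  rw [moment_laguerrePoly_mul_eq_zero m n _ (natDegree_normLaguerre_le m) (by omega),
    moment_laguerrePoly_mul_eq_zero m (n + 1) _ (natDegree_normLaguerre_le m) (by omega),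
    moment_laguerrePoly_mul_of_lt (by omega : m < n),
    moment_laguerrePoly_mul_of_lt (by omega : m < n + 1),
    moment_laguerrePoly_mul_of_lt (by omega : m + 1 < n),
    moment_laguerrePoly_mul_of_lt (by omega : m + 1 < n + 1)]
  ring

/-! ### The orthogonalized polynomials -/

/-- The Sobolev orthogonal polynomials, in the normalization of `normLaguerre`. -/
noncomputable def normSobolev (lam : ℝ) : ℕ → ℝ[X]
  | 0 => normLaguerre 0
  | n + 1 => normLaguerre (n + 1) - (1 / sobolevNormSeq lam n) • normSobolev lam n

theorem natDegree_normSobolev_le (lam : ℝ) (n : ℕ) : (normSobolev lam n).natDegree ≤ n := by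
  induction n with
  | zero => exact natDegree_normLaguerre_le 0
  | succ n ih =>
    rw [normSobolev]
    refine (natDegree_sub_le _ _).trans (max_le (natDegree_normLaguerre_le _) ?_)
    exact (natDegree_smul_le _ _).trans (ih.trans n.le_succ)

theorem normSobolev_coeff (lam : ℝ) (n : ℕ) :
    (normSobolev lam n).coeff n = (-1) ^ n / (n + 1).factorial := by
  have h : (normSobolev lam n).coeff n = (normLaguerre n).coeff n := by
    rcases n with _ | n
    · rfl
    · rw [normSobolev, coeff_sub, coeff_smul, coeff_eq_zero_of_natDegree_lt
        (Nat.lt_succ_of_le (natDegree_normSobolev_le lam n)), smul_zero, sub_zero]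
  rw [h, normLaguerre_coeff, Nat.choose_self, Nat.cast_one, mul_one]

theorem sobolevForm_normLaguerre_normSobolev (lam : ℝ) (m : ℕ) :
    ∀ n, m + 2 ≤ n → sobolevForm lam (normLaguerre n) (normSobolev lam m) = 0 := by
  induction m with
  | zero => exact fun n hn => sobolevForm_normLaguerre_of_lt lam hn
  | succ m ih =>
    intro n hn
    rw [normSobolev, map_sub, map_smul, ih n (by omega), sobolevForm_normLaguerre_of_lt lam hn]
    simp

theorem sobolevForm_normLaguerre_succ_normSobolev (lam : ℝ) (n : ℕ) :
    sobolevForm lam (normLaguerre (n + 1)) (normSobolev lam n) = 1 / 4 := by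
  rcases n with _ | n
  · exact sobolevForm_normLaguerre_succ lam 0
  · rw [normSobolev, map_sub, map_smul, sobolevForm_normLaguerre_normSobolev lam n _ le_rfl,
      sobolevForm_normLaguerre_succ]
    simp

theorem sobolevForm_normSobolev {lam : ℝ} (hlam : 0 < lam) (n : ℕ) :
    sobolevForm lam (normSobolev lam n) (normSobolev lam n) = sobolevNormSeq lam n / 4 ∧
      ∀ m < n, sobolevForm lam (normSobolev lam n) (normSobolev lam m) = 0 := by
  induction n with
  | zero =>
    refine ⟨?_, fun m hm => absurd hm m.not_lt_zero⟩
    rw [normSobolev, sobolevForm_normLaguerre_self, sobolevNormSeq]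
    push_cast
    ring
  | succ n ih =>
    have hr := (zero_lt_one.trans (one_lt_sobolevNormSeq hlam n)).ne'
    have hn : sobolevForm lam (normSobolev lam (n + 1)) (normSobolev lam n) = 0 := by
      rw [normSobolev, map_sub, map_smul, LinearMap.sub_apply, LinearMap.smul_apply, ih.1,
        sobolevForm_normLaguerre_succ_normSobolev, smul_eq_mul]
      field_simp
      ring
    refine ⟨?_, fun m hm => ?_⟩
    -- Orthogonality to the previous polynomial lets one factor be replaced by `normLaguerre (n +
    -- 1)`; what remains is exactly the recurrence defining `sobolevNormSeq`.
    · have h1 : sobolevForm lam (normSobolev lam (n + 1)) (normSobolev lam (n + 1)) =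
          sobolevForm lam (normSobolev lam (n + 1)) (normLaguerre (n + 1)) := by
        conv_lhs => rw [normSobolev.eq_2 lam n, map_sub, map_smul, ← normSobolev.eq_2 lam n, hn]
        simp
      rw [h1, sobolevForm_comm, normSobolev, map_sub, map_smul,
        sobolevForm_normLaguerre_succ_normSobolev, sobolevForm_normLaguerre_self, sobolevNormSeq,
        smul_eq_mul]
      push_cast
      field_simp
      ring
    · rcases (Nat.lt_succ_iff.mp hm).eq_or_lt with rfl | hlt
      · exact hn
      · rw [normSobolev, map_sub, map_smul, LinearMap.sub_apply, LinearMap.smul_apply, ih.2 m hlt,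
          sobolevForm_normLaguerre_normSobolev lam m _ (by omega)]
        simp

theorem exists_eq_sum_of_degree_lt {Q : ℕ → ℝ[X]} (hdeg : ∀ n, (Q n).natDegree ≤ n)
    (hlead : ∀ n, (Q n).coeff n ≠ 0) (n : ℕ) :
    ∀ p : ℝ[X], p.degree < n → ∃ d : ℕ → ℝ, p = ∑ i ∈ Finset.range n, d i • Q i := by
  induction n with
  | zero => exact fun p hp => ⟨0, by simpa using hp⟩
  | succ n ih =>
    intro p hp
    obtain ⟨d, hd⟩ := ih (p - (p.coeff n / (Q n).coeff n) • Q n) (by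
      rw [degree_lt_iff_coeff_zero]
      intro m hm
      rw [coeff_sub, coeff_smul, smul_eq_mul]
      rcases hm.eq_or_lt with rfl | hlt
      · rw [div_mul_cancel₀ _ (hlead n), sub_self]
      · rw [(degree_lt_iff_coeff_zero _ _).mp hp m hlt,
          coeff_eq_zero_of_natDegree_lt ((hdeg n).trans_lt hlt), mul_zero, sub_zero])
    refine ⟨Function.update d n (p.coeff n / (Q n).coeff n), ?_⟩
    rw [Finset.sum_range_succ, Function.update_self, ← sub_eq_iff_eq_add, hd]
    refine Finset.sum_congr rfl fun i hi => ?_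
    rw [Function.update_of_ne (Finset.mem_range.mp hi).ne]

/-- Uniqueness of Gram-Schmidt: X^n minus the monic multiple of Q_n has degree below n, so it
expands in the earlier Q_i, and pairing X^n with Q_i shows that the coefficients are the
Gram-Schmidt projections. -/
theorem sobolevGramSchmidt_eq_of_orthogonal {lam : ℝ} {Q : ℕ → ℝ[X]}
    (hdeg : ∀ n, (Q n).natDegree ≤ n) (hlead : ∀ n, (Q n).coeff n ≠ 0)
    (hpos : ∀ n, sobolevForm lam (Q n) (Q n) ≠ 0)
    (horth : ∀ m n, m ≠ n → sobolevForm lam (Q m) (Q n) = 0) (n : ℕ) :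
    sobolevGramSchmidt lam n = (1 / (Q n).coeff n) • Q n := by
  induction n using Nat.strong_induction_on with
  | _ n ih =>
    obtain ⟨d, hd⟩ := exists_eq_sum_of_degree_lt hdeg hlead n
      (X ^ n - (1 / (Q n).coeff n) • Q n) (by
        rw [degree_lt_iff_coeff_zero]
        intro m hm
        rw [coeff_sub, coeff_smul, smul_eq_mul, coeff_X_pow]
        rcases hm.eq_or_lt with rfl | hlt
        · rw [if_pos rfl, one_div_mul_cancel (hlead n), sub_self]
        · rw [if_neg hlt.ne', coeff_eq_zero_of_natDegree_lt ((hdeg n).trans_lt hlt), mul_zero,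
            sub_zero])
    have hX : ∀ i < n, sobolevForm lam (X ^ n) (Q i) = d i * sobolevForm lam (Q i) (Q i) := by
      intro i hi
      rw [sub_eq_iff_eq_add.mp hd, map_add, map_smul, map_sum, LinearMap.add_apply,
        LinearMap.smul_apply, horth n i hi.ne', LinearMap.sum_apply, smul_zero, add_zero,
        Finset.sum_eq_single_of_mem i (Finset.mem_range.mpr hi)]
      · rw [map_smul, LinearMap.smul_apply, smul_eq_mul]
      · intro j _ hj
        rw [map_smul, LinearMap.smul_apply, horth j i hj, smul_zero]
    rw [sobolevGramSchmidt, sub_eq_iff_eq_add, add_comm, ← sub_eq_iff_eq_add, hd,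
      ← Fin.sum_univ_eq_sum_range (fun i => d i • Q i) n]
    refine Finset.sum_congr rfl fun i _ => ?_
    rw [ih i i.isLt, sobolevInner_testFun, sobolevInner_testFun]
    simp only [map_smul, LinearMap.smul_apply, smul_eq_mul]
    rw [hX i i.isLt, ← smul_eq_C_mul, smul_smul]
    congr 1
    have h1 := hlead i
    have h2 := hpos i
    field_simp

theorem laguerreSobolev_eq {lam : ℝ} (hlam : 0 < lam) (n : ℕ) :
    laguerreSobolev lam n = C ((n : ℝ) + 1) * normSobolev lam n := by
  have h := sobolevGramSchmidt_eq_of_orthogonal (lam := lam) (natDegree_normSobolev_le lam)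
    (fun k => by rw [normSobolev_coeff]; positivity)
    (fun k => by
      rw [(sobolevForm_normSobolev hlam k).1]
      have := one_lt_sobolevNormSeq hlam k
      positivity)
    (fun i j hij => by
      rcases lt_or_gt_of_ne hij with h | h
      · rw [sobolevForm_comm]; exact (sobolevForm_normSobolev hlam j).2 i h
      · exact (sobolevForm_normSobolev hlam i).2 j h) n
  rw [laguerreSobolev, h, normSobolev_coeff, smul_eq_C_mul, ← mul_assoc, ← C_mul,
    Nat.factorial_succ]
  congr 2
  have h3 : ((n.factorial : ℕ) : ℝ) ≠ 0 := by positivity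
  push_cast
  field_simp

/-! ### The convergence theorem -/

theorem aeval_normLaguerre_zero (x : ℂ) : aeval x (normLaguerre 0) = 1 := by
  simp [normLaguerre, laguerrePoly]

theorem aeval_normLaguerre_recurrence (x : ℂ) (n : ℕ) :
    ((n : ℂ) + 1) * (n + 2) * (aeval x (normLaguerre (n + 1)) - aeval x (normLaguerre n)) =
      (n : ℂ) * (n + 1) * (aeval x (normLaguerre n) - aeval x (normLaguerre (n - 1))) +
        (n + 1) * (-x * aeval x (normLaguerre n)) := by
  have h := congrArg (aeval x) (normLaguerre_recurrence n)
  simp only [map_mul, map_sub, aeval_X, map_add, map_one, map_natCast, map_ofNat] at h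
  rw [h]
  ring

theorem aeval_normLaguerre_ne_zero {x : ℂ} (hx : ∀ t : ℝ, 0 < t → x ≠ (t : ℂ)) (n : ℕ) :
    aeval x (normLaguerre n) ≠ 0 := by
  by_cases h : x = 0
  · rw [h, ← coeff_zero_eq_aeval_zero', normLaguerre_coeff]
    simp
  · refine ne_zero_of_recurrence (b := fun n => aeval x (normLaguerre n))
      (aeval_normLaguerre_recurrence x) (by simp [aeval_normLaguerre_zero]) (fun t ht h' => ?_) n
    rcases ht.eq_or_lt with rfl | ht
    · simp at h'; exact h h'
    · exact hx t ht (by linear_combination -h')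

theorem norm_sobolevRatio_le {lam : ℝ} (hlam : 0 < lam) {x : ℂ}
    (hx : ∀ t : ℝ, 0 < t → x ≠ (t : ℂ)) {c : ℝ} (hc : 0 < c)
    (hcx : ∀ t : ℝ, 0 ≤ t → c * ‖x‖ ≤ ‖x - (t : ℂ)‖) (n : ℕ) :
    ‖sobolevRatio lam n x‖ ≤
      1 / √((n : ℝ) + 1) + (1 + 1 / c) * √(n * dampedSum (sobolevNormSeq lam) n) := by
  obtain ⟨b, hb⟩ : ∃ b : ℕ → ℂ, b = fun n => aeval x (normLaguerre n) := ⟨_, rfl⟩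
  obtain ⟨T, hT⟩ : ∃ T : ℕ → ℂ, T = fun n => aeval x (normSobolev lam n) := ⟨_, rfl⟩
  have hb0 : b n ≠ 0 := by rw [hb]; exact aeval_normLaguerre_ne_zero hx n
  have h1 := norm_le_of_alternating_recurrence (r := sobolevNormSeq lam)
    (one_lt_sobolevNormSeq hlam) (b := b) (T := T) (by rw [hb, hT]; rfl)
    (fun k => by
      rw [hb, hT]
      simp only [normSobolev, map_sub, map_smul]
      rw [Complex.real_smul]) n
  -- The sign z = -x turns distance to the positive ray into a lower bound for |z + t| with t ≥ 0.
  have h2 := dirichletEnergy_le (z := -x) (b := b)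
    (by rw [hb]; exact aeval_normLaguerre_recurrence x)
    (by rw [hb]; simp [aeval_normLaguerre_zero]) hc
    (fun t ht => by
      rw [norm_neg, neg_add_eq_sub, norm_sub_rev]
      exact hcx t ht) n
  have hW := dampedSum_nonneg (sobolevNormSeq lam) n
  set W := dampedSum (sobolevNormSeq lam) n
  obtain ⟨s, hs⟩ : ∃ s, s = √((n : ℝ) + 1) := ⟨_, rfl⟩
  have hs0 : 0 < s := by rw [hs]; positivity
  have hss : s ^ 2 = n + 1 := by rw [hs, Real.sq_sqrt (by positivity)]
  have hbn : 0 < ‖b n‖ := norm_pos_iff.mpr hb0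
  have h3 : √(dirichletEnergy b n * W) ≤ (1 + 1 / c) * s * ‖b n‖ * √(n * W) := by
    refine Real.sqrt_le_iff.mpr ⟨by positivity, ?_⟩
    rw [mul_pow, mul_pow, mul_pow, hss, Real.sq_sqrt (by positivity)]
    calc dirichletEnergy b n * W ≤ (1 + 1 / c) ^ 2 * (n * (n + 1)) * ‖b n‖ ^ 2 * W := by gcongr
      _ = _ := by ring
  have h4 : sobolevRatio lam n x = T n / (s * b n) := by
    have h5 : ((n : ℂ) + 1) ≠ 0 := Nat.cast_add_one_ne_zero n
    rw [sobolevRatio, laguerreSobolev_eq hlam, laguerrePoly_one_eq, hs, hT, hb]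
    simp only [map_mul, map_add, map_one, map_natCast]
    rw [mul_left_comm, mul_div_mul_left _ _ h5]
  rw [h4, norm_div, norm_mul, Complex.norm_of_nonneg hs0.le, ← hs, div_le_iff₀ (by positivity)]
  calc ‖T n‖ ≤ ‖b n‖ + (1 + 1 / c) * s * ‖b n‖ * √(n * W) := by linarith
    _ = _ := by field_simp

theorem tendstoUniformlyOn_sobolevRatio {lam : ℝ} (hlam : 0 < lam) {K : Set ℂ}
    (hK : ∀ x ∈ K, ∀ t : ℝ, 0 < t → x ≠ (t : ℂ))
    (hc : ∃ c : ℝ, 0 < c ∧ ∀ x ∈ K, ∀ t : ℝ, 0 ≤ t → c * ‖x‖ ≤ ‖x - (t : ℂ)‖) :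
    TendstoUniformlyOn (sobolevRatio lam) (fun _ => 0) Filter.atTop K := by
  obtain ⟨c, hc0, hc⟩ := hc
  have h1 : Filter.Tendsto (fun n : ℕ => 1 / √((n : ℝ) + 1) +
      (1 + 1 / c) * √(n * dampedSum (sobolevNormSeq lam) n)) Filter.atTop (nhds 0) := by
    have hs : Filter.Tendsto (fun n : ℕ => √((n : ℝ) + 1)) Filter.atTop Filter.atTop :=
      Real.tendsto_sqrt_atTop.comp
        (Filter.tendsto_atTop_add_const_right _ _ tendsto_natCast_atTop_atTop)
    have h2 := (tendsto_mul_dampedSum (c := √(2 * lam)) (by positivity)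
      (one_add_le_sobolevNormSeq hlam)).sqrt.const_mul (1 + 1 / c)
    simpa using (hs.const_div_atTop 1).add h2
  rw [Metric.tendstoUniformlyOn_iff]
  intro ε hε
  filter_upwards [h1.eventually (gt_mem_nhds hε)] with n hn x hx
  rw [dist_zero_left]
  exact (norm_sobolevRatio_le hlam (hK x hx) hc0 (hc x hx) n).trans_lt hn

/-- A compact set disjoint from the closed ray has positive distance m from it and lies in a disc of
radius R about 0, so c = m/R works. -/
theorem exists_mul_norm_le_norm_sub_ray {K : Set ℂ} (hK : IsCompact K)
    (h : ∀ x ∈ K, ∀ t : ℝ, 0 ≤ t → x ≠ (t : ℂ)) :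
    ∃ c : ℝ, 0 < c ∧ ∀ x ∈ K, ∀ t : ℝ, 0 ≤ t → c * ‖x‖ ≤ ‖x - (t : ℂ)‖ := by
  have hclosed : IsClosed ((fun t : ℝ => (t : ℂ)) '' Set.Ici 0) :=
    Complex.isometry_ofReal.isClosedEmbedding.isClosedMap _ isClosed_Ici
  obtain ⟨m, hm0, hm⟩ := (Metric.exists_pos_forall_lt_edist hK hclosed (by
    rw [Set.disjoint_right]
    rintro _ ⟨t, ht, rfl⟩ hx
    exact h _ hx t ht rfl))
  obtain ⟨R, hR0, hR⟩ := hK.isBounded.exists_pos_norm_le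
  refine ⟨m / R, by positivity, fun x hx t ht => ?_⟩
  have h1 := hm x hx _ ⟨t, ht, rfl⟩
  rw [edist_dist, ENNReal.lt_ofReal_iff_toReal_lt ENNReal.coe_ne_top, dist_eq_norm] at h1
  calc m / R * ‖x‖ ≤ m / R * R := by gcongr; exact hR x hx
    _ = m := by field_simp
    _ ≤ _ := h1.le

theorem mainTheorem4 (lam : ℝ) (hlam : 0 < lam) :
    -- the quotients are defined at every point off `(0, +∞)`
    (∀ (n : ℕ) (x : ℂ), (∀ t : ℝ, 0 < t → x ≠ (t : ℂ)) →
      Polynomial.aeval x (laguerrePoly 1 n) ≠ 0) ∧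
    -- pointwise convergence off `(0, +∞)`
    (∀ x : ℂ, (∀ t : ℝ, 0 < t → x ≠ (t : ℂ)) →
      Filter.Tendsto (fun n : ℕ => sobolevRatio lam n x) Filter.atTop (nhds 0)) ∧
    -- uniform convergence on compact sets that do not meet `[0, +∞)`
    (∀ K : Set ℂ, IsCompact K → (∀ x ∈ K, ∀ t : ℝ, 0 ≤ t → x ≠ (t : ℂ)) →
      TendstoUniformlyOn (sobolevRatio lam) (fun _ => 0) Filter.atTop K) ∧
    -- uniform convergence on closed sets, possibly unbounded or containing `0`, that do not
    -- approach the ray tangentially at `0` or at infinity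
    (∀ K : Set ℂ, IsClosed K → (∀ x ∈ K, ∀ t : ℝ, 0 < t → x ≠ (t : ℂ)) →
      (∃ c : ℝ, 0 < c ∧ ∀ x ∈ K, ∀ t : ℝ, 0 ≤ t → c * ‖x‖ ≤ ‖x - (t : ℂ)‖) →
      TendstoUniformlyOn (sobolevRatio lam) (fun _ => 0) Filter.atTop K) := by
  refine ⟨fun n x hx => ?_, fun x hx => ?_, fun K hK h => ?_, fun K _ h hc => ?_⟩
  · rw [laguerrePoly_one_eq, map_mul, aeval_C]
    refine mul_ne_zero ?_ (aeval_normLaguerre_ne_zero hx n)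
    simpa using Nat.cast_add_one_ne_zero (R := ℂ) n
  · have h : TendstoUniformlyOn (sobolevRatio lam) (fun _ => 0) Filter.atTop {x} := by
      refine tendstoUniformlyOn_sobolevRatio hlam (by rintro _ rfl; exact hx) ?_
      -- The origin lies on the closed ray, so compactness does not apply there; the cone condition
      -- is trivial because |x| = 0.
      by_cases h0 : x = 0
      · exact ⟨1, one_pos, by rintro _ rfl t _; simp [h0]⟩
      · refine exists_mul_norm_le_norm_sub_ray isCompact_singleton ?_
        rintro _ rfl t ht
        rcases ht.eq_or_lt with rfl | ht
        · simpa using h0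
        · exact hx t ht
    exact h.tendsto_at rfl
  · exact tendstoUniformlyOn_sobolevRatio hlam (fun x hx t ht => h x hx t ht.le)
      (exists_mul_norm_le_norm_sub_ray hK h)
  · exact tendstoUniformlyOn_sobolevRatio hlam h hc
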